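/- Let $M$ be a non-empty smooth manifold of dimension $2m+1$ with a Sasakian structure $(\phi,\xi,\eta,g_M)$: $\phi$ is a smooth $(1,1)$-tensor field, $\xi$ a smooth vector field, $\eta$ a smooth $1$-form and $g_M$ a Riemannian metric with $$\phi^2=-I+\eta\otimes\xi,\quad \phi\xi=0,\quad \eta\circ\phi=0,\quad \eta(\xi)=1,$$ $$g_M(\phi X,\phi Y)=g_M(X,Y)-\eta(X)\eta(Y),\quad \eta(X)=g_M(X,\xi),$$ $$d\eta(X,Y)=g_M(X,\phi Y),\qquad N_\phi+2\,d\eta\otimes\xi=0,$$ where $2\,d\eta(X,Y)=X\eta(Y)-Y\eta(X)-\eta([X,Y])$ and $N_\phi(X,Y)=\phi^2[X,Y]+[\phi X,\phi Y]-\phi[\phi X,Y]-\phi[X,\phi Y]$. Let $(N,g_N)$ be a Riemannian manifold of dimension $n<2m+1$, and let $F:M\to N$ be an anti-invariant Riemannian submersion, that is, a smooth surjective map whose differential $F_*$ is surjective at every point, preserves the lengths of the vectors of $(\ker F_*)^\perp$, and satisfies $\phi(\ker F_*)\subset(\ker F_*)^\perp$. Assume that $\xi$ is horizontal, i.e. a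 section of $(\ker F_*)^\perp$. Then the horizontal distribution $(\ker F_*)^\perp$ does not define a totally geodesic foliation on $M$; that is, with $\nabla$ the Levi-Civita connection of $g_M$, it is not true that $\nabla_XY$ is a section of $(\ker F_*)^\perp$ for all sections $X,Y$ of $(\ker F_*)^\perp$. -/

import Mathlib

open Bundle VectorField
open scoped Manifold ContDiff

set_option linter.unusedSectionVars false

namespace SasakianGeometry

noncomputable section

section LeviCivita

variable {E : Type*} [NormedAddCommGroup E] [NormedSpace ℝ E] [FiniteDimensional ℝ E]
  {H : Type*} [TopologicalSpace H] {I : ModelWithCorners ℝ E H}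
  {M : Type*} [TopologicalSpace M] [ChartedSpace H M] [IsManifold I ∞ M]
  [RiemannianBundle (fun x : M ↦ TangentSpace I x)]
  [IsContMDiffRiemannianBundle I ∞ E (fun x : M ↦ TangentSpace I x)]

local notation "⟪" x ", " y "⟫" => inner ℝ x y

theorem mdifferentiableAt_inner {X Y : Π x : M, TangentSpace I x} {x : M}
    (hX : MDiffAt (T% X) x) (hY : MDiffAt (T% Y) x) : MDiffAt (fun y ↦ ⟪X y, Y y⟫) x :=
  MDifferentiableAt.inner_bundle (IB := I) (F := E) (E := fun x : M ↦ TangentSpace I x) (b := fun x ↦ x) hX hY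

/-- The right-hand side of the Koszul formula, which is `2 ⟨∇_X Y, Z⟩` for the Levi-Civita
connection `∇`. -/
def koszul (X Y Z : Π x : M, TangentSpace I x) (x : M) : ℝ :=
  mvfderiv I (fun y ↦ ⟪Y y, Z y⟫) x (X x) + mvfderiv I (fun y ↦ ⟪Z y, X y⟫) x (Y x)
    - mvfderiv I (fun y ↦ ⟪X y, Y y⟫) x (Z x)
    + ⟪mlieBracket I X Y x, Z x⟫ - ⟪mlieBracket I Y Z x, X x⟫ - ⟪mlieBracket I X Z x, Y x⟫

theorem tensorialAt_koszul_left (Y Z : Π x : M, TangentSpace I x) (x : M)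
    (hY : MDiffAt (T% Y) x) (hZ : MDiffAt (T% Z) x) :
    TensorialAt I E (fun X ↦ koszul X Y Z x) x where
  smul {f X} hf hX := by
    simp [koszul, inner_smul_left, inner_smul_right, mvfderiv_fun_mul hf (mdifferentiableAt_inner hZ hX), mvfderiv_fun_mul hf (mdifferentiableAt_inner hY hX),
     mlieBracket_smul_left hf hX, inner_add_left, real_inner_comm]
    ring
  add {X X'} hX hX' := by
    simp [koszul, mvfderiv_fun_add (mdifferentiableAt_inner hZ hX) (mdifferentiableAt_inner hZ hX'), mvfderiv_fun_add (mdifferentiableAt_inner hX hY) (mdifferentiableAt_inner hX' hY),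
     mlieBracket_add_left hX hX', inner_add_left, inner_add_right]
    ring

theorem tensorialAt_koszul_right (X Y : Π x : M, TangentSpace I x) (x : M)
    (hX : MDiffAt (T% X) x) (hY : MDiffAt (T% Y) x) :
    TensorialAt I E (fun Z ↦ koszul X Y Z x) x where
  smul {f Z} hf hZ := by
    simp [koszul, inner_smul_left, inner_smul_right, mvfderiv_fun_mul hf (mdifferentiableAt_inner hX hZ), mvfderiv_fun_mul hf (mdifferentiableAt_inner hY hZ),
     mlieBracket_smul_right hf hZ, inner_add_left, real_inner_comm]
    ring
  add {Z Z'} hZ hZ' := by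
    simp [koszul, mvfderiv_fun_add (mdifferentiableAt_inner hZ hX) (mdifferentiableAt_inner hZ' hX), mvfderiv_fun_add (mdifferentiableAt_inner hY hZ) (mdifferentiableAt_inner hY hZ'),
     mlieBracket_add_right hZ hZ', inner_add_left, inner_add_right]
    ring

theorem koszul_smul_mid (X Y Z : Π x : M, TangentSpace I x) {f : M → ℝ} (x : M) (hf : MDiffAt f x)
    (hX : MDiffAt (T% X) x) (hY : MDiffAt (T% Y) x) (hZ : MDiffAt (T% Z) x) :
    koszul X (f • Y) Z x = f x * koszul X Y Z x + 2 * (mvfderiv I f x (X x) * ⟪Y x, Z x⟫) := by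
  simp [koszul, inner_smul_left, inner_smul_right, mvfderiv_fun_mul hf (mdifferentiableAt_inner hX hY), mvfderiv_fun_mul hf (mdifferentiableAt_inner hY hZ),
     mlieBracket_smul_right hf hY, mlieBracket_smul_left hf hY, inner_add_left, real_inner_comm]
  ring

theorem koszul_add_mid (X Y Y' Z : Π x : M, TangentSpace I x) (x : M)
    (hX : MDiffAt (T% X) x) (hY : MDiffAt (T% Y) x) (hY' : MDiffAt (T% Y') x) (hZ : MDiffAt (T% Z) x) :
    koszul X (Y + Y') Z x = koszul X Y Z x + koszul X Y' Z x := by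
  simp [koszul, mvfderiv_fun_add (mdifferentiableAt_inner hX hY) (mdifferentiableAt_inner hX hY'), mvfderiv_fun_add (mdifferentiableAt_inner hY hZ) (mdifferentiableAt_inner hY' hZ),
     mlieBracket_add_right hY hY', mlieBracket_add_left hY hY', inner_add_left, inner_add_right]
  ring


theorem finiteDimensional_tangentSpace (x : M) : FiniteDimensional ℝ (TangentSpace I x) :=
  inferInstanceAs (FiniteDimensional ℝ E)

open Classical in
/-- For a vector field `Y` that is differentiable at `x`, the linear map `v ↦ ∇_v Y` determined by
the Koszul formula (zero where `Y` is not differentiable). -/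
def leviCivitaFun (Y : Π x : M, TangentSpace I x) (x : M) :
    TangentSpace I x →L[ℝ] TangentSpace I x :=
  haveI : FiniteDimensional ℝ (TangentSpace I x) := finiteDimensional_tangentSpace x
  haveI : CompleteSpace (TangentSpace I x) := FiniteDimensional.complete ℝ _
  if hY : MDiffAt (T% Y) x then
    LinearMap.toContinuousLinearMap
    { toFun := fun v ↦ (2⁻¹ : ℝ) • (InnerProductSpace.toDual ℝ (TangentSpace I x)).symm
        (TensorialAt.mkHom₂ (fun X Z ↦ koszul X Y Z x) x
          (fun Z hZ ↦ tensorialAt_koszul_left Y Z x hY hZ)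
          (fun X hX ↦ tensorialAt_koszul_right X Y x hX hY) v)
      map_add' := fun v w ↦ by rw [map_add, map_add, smul_add]
      map_smul' := fun c v ↦ by
        rw [map_smul, map_smulₛₗ, smul_comm]
        rfl }
  else 0

theorem inner_leviCivitaFun (X Y Z : Π x : M, TangentSpace I x) (x : M)
    (hX : MDiffAt (T% X) x) (hY : MDiffAt (T% Y) x) (hZ : MDiffAt (T% Z) x) :
    ⟪leviCivitaFun Y x (X x), Z x⟫ = 2⁻¹ * koszul X Y Z x := by
  simp only [leviCivitaFun, hY, dif_pos]
  have : FiniteDimensional ℝ (TangentSpace I x) := finiteDimensional_tangentSpace x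
  have : CompleteSpace (TangentSpace I x) := FiniteDimensional.complete ℝ _
  simp only [LinearMap.coe_toContinuousLinearMap', LinearMap.coe_mk, AddHom.coe_mk,
    real_inner_smul_left, InnerProductSpace.toDual_symm_apply]
  congr 1
  exact TensorialAt.mkHom₂_apply _ _ hX hZ

theorem eq_of_inner_mdifferentiable {x : M} {A B : TangentSpace I x →L[ℝ] TangentSpace I x}
    (h : ∀ X Z : Π x : M, TangentSpace I x, MDiffAt (T% X) x → MDiffAt (T% Z) x →
      ⟪A (X x), Z x⟫ = ⟪B (X x), Z x⟫) : A = B := by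
  ext v
  refine ext_inner_right ℝ fun w ↦ ?_
  simpa using h (FiberBundle.extend E v) (FiberBundle.extend E w)
    (FiberBundle.mdifferentiableAt_extend ..) (FiberBundle.mdifferentiableAt_extend ..)

variable (I M) in
/-- The Levi-Civita connection; `leviCivita I M Y x v` is `∇_v Y` at `x`. It is torsion-free and
metric, see `torsion_leviCivita` and `leviCivita_metric`. -/
def leviCivita : CovariantDerivative I E (TangentSpace I : M → Type _) where
  toFun := leviCivitaFun
  isCovariantDerivativeOnUniv :=
    { add := fun {Y Y' x} hY hY' _ ↦ eq_of_inner_mdifferentiable fun X Z hX hZ ↦ by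
        rw [inner_leviCivitaFun X _ Z x hX (mdifferentiableAt_add_section hY hY') hZ,
          koszul_add_mid X Y Y' Z x hX hY hY' hZ, add_apply, inner_add_left,
          inner_leviCivitaFun X Y Z x hX hY hZ, inner_leviCivitaFun X Y' Z x hX hY' hZ]
        ring
      leibniz := fun {Y f x} hY hf _ ↦ eq_of_inner_mdifferentiable fun X Z hX hZ ↦ by
        rw [inner_leviCivitaFun X _ Z x hX (hf.smul_section hY) hZ,
          koszul_smul_mid X Y Z x hf hX hY hZ, add_apply, inner_add_left,
          smul_apply, real_inner_smul_left,
          inner_leviCivitaFun X Y Z x hX hY hZ, ContinuousLinearMap.smulRight_apply,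
          real_inner_smul_left]
        ring }

theorem torsion_leviCivita : (leviCivita I M).torsion = 0 := by
  rw [CovariantDerivative.torsion_eq_zero_iff]
  intro X Y x hX hY
  refine ext_inner_right ℝ fun w ↦ ?_
  have hZ : MDiffAt (T% (FiberBundle.extend E w)) x := FiberBundle.mdifferentiableAt_extend ..
  have h1 := inner_leviCivitaFun X Y _ x hX hY hZ
  have h2 := inner_leviCivitaFun Y X _ x hY hX hZ
  rw [FiberBundle.extend_apply_self] at h1 h2
  change ⟪leviCivitaFun Y x (X x) - leviCivitaFun X x (Y x), w⟫ = _
  rw [inner_sub_left, h1, h2]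
  simp only [koszul, FiberBundle.extend_apply_self]
  rw [mlieBracket_swap (V := Y) (W := X)]
  simp only [Pi.neg_apply, inner_neg_left, real_inner_comm]
  ring


theorem leviCivita_metric {X Y Z : Π x : M, TangentSpace I x} {x : M} (hX : MDiffAt (T% X) x) (hY : MDiffAt (T% Y) x) (hZ : MDiffAt (T% Z) x) :
    mvfderiv I (fun y ↦ ⟪Y y, Z y⟫) x (X x) =
      ⟪leviCivita I M Y x (X x), Z x⟫ + ⟪Y x, leviCivita I M Z x (X x)⟫ := by
  have h1 := inner_leviCivitaFun X Y Z x hX hY hZ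
  have h2 := inner_leviCivitaFun X Z Y x hX hZ hY
  change _ = ⟪leviCivitaFun Y x (X x), Z x⟫ + ⟪Y x, leviCivitaFun Z x (X x)⟫
  rw [real_inner_comm (leviCivitaFun Z x (X x)), h1, h2]
  simp only [koszul]
  rw [mlieBracket_swap (V := Z) (W := Y)]
  simp only [Pi.neg_apply, inner_neg_left, real_inner_comm]
  ring

/-- The distribution `D` on the Riemannian manifold `M` defines a totally geodesic foliation:
`∇_X Y` is a section of `D` for all sections `X` and `Y` of `D`. As `∇_X Y` depends on `X` only
through the value of `X` at the point considered, this value is written as a vector `v` of `D x`.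
As `∇` has no torsion, `[X, Y] = ∇_X Y - ∇_Y X` is then a section of `D` too, so that `D` is
integrable, and its leaves are totally geodesic because their second fundamental form vanishes. -/
def DefinesTotallyGeodesicFoliation (D : Π x : M, Submodule ℝ (TangentSpace I x)) : Prop :=
  ∀ Y : Π x : M, TangentSpace I x, CMDiff ∞ (T% Y) → (∀ x, Y x ∈ D x) →
    ∀ (x : M) (v : TangentSpace I x), v ∈ D x → leviCivita I M Y x v ∈ D x

end LeviCivita

section AlmostContact

variable {E : Type*} [NormedAddCommGroup E] [NormedSpace ℝ E]
  {H : Type*} [TopologicalSpace H]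

/-- An almost contact structure `(φ, ξ, η)` on a manifold: a smooth tensor field `φ` of type
`(1,1)`, a smooth vector field `ξ` and a smooth 1-form `η` with `φ² = -I + η ⊗ ξ`, `φ ξ = 0`,
`η ∘ φ = 0` and `η(ξ) = 1`. -/
structure AlmostContactStructure (I : ModelWithCorners ℝ E H) (M : Type*) [TopologicalSpace M]
    [ChartedSpace H M] [IsManifold I ∞ M] where
  phi : Π x : M, TangentSpace I x →L[ℝ] TangentSpace I x
  xi : Π x : M, TangentSpace I x
  eta : Π x : M, TangentSpace I x →L[ℝ] ℝ
  contMDiff_phi : ContMDiff I (I.prod 𝓘(ℝ, E →L[ℝ] E)) ∞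
    (fun x ↦ TotalSpace.mk' (E →L[ℝ] E) (E := fun x ↦ TangentSpace I x →L[ℝ] TangentSpace I x)
      x (phi x))
  contMDiff_xi : ContMDiff I (I.prod 𝓘(ℝ, E)) ∞
    (fun x ↦ TotalSpace.mk' E (E := fun x ↦ TangentSpace I x) x (xi x))
  contMDiff_eta : ContMDiff I (I.prod 𝓘(ℝ, E →L[ℝ] ℝ)) ∞
    (fun x ↦ TotalSpace.mk' (E →L[ℝ] ℝ) (E := fun x ↦ TangentSpace I x →L[ℝ] Trivial M ℝ x)
      x (eta x))
  phi_phi : ∀ x v, phi x (phi x v) = -v + eta x v • xi x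
  phi_xi : ∀ x, phi x (xi x) = 0
  eta_phi : ∀ x v, eta x (phi x v) = 0
  eta_xi : ∀ x, eta x (xi x) = 1

variable {I : ModelWithCorners ℝ E H} {M : Type*} [TopologicalSpace M] [ChartedSpace H M]

/-- The exterior derivative of a 1-form, evaluated on two vector fields, in the convention
`2 dη(X, Y) = X(η(Y)) - Y(η(X)) - η([X, Y])` that is usual in contact geometry. -/
def extDerivOneForm (eta : Π x : M, TangentSpace I x →L[ℝ] ℝ) (X Y : Π x : M, TangentSpace I x)
    (x : M) : ℝ :=
  2⁻¹ * (mvfderiv I (fun y ↦ eta y (Y y)) x (X x) - mvfderiv I (fun y ↦ eta y (X y)) x (Y x)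
    - eta x (mlieBracket I X Y x))

/-- The Nijenhuis tensor
`N(X, Y) = φ²[X, Y] + [φ X, φ Y] - φ[φ X, Y] - φ[X, φ Y]` of a `(1,1)`-tensor field. -/
def nijenhuis (phi : Π x : M, TangentSpace I x →L[ℝ] TangentSpace I x)
    (X Y : Π x : M, TangentSpace I x) (x : M) : TangentSpace I x :=
  phi x (phi x (mlieBracket I X Y x))
    + mlieBracket I (fun y ↦ phi y (X y)) (fun y ↦ phi y (Y y)) x
    - phi x (mlieBracket I (fun y ↦ phi y (X y)) Y x)
    - phi x (mlieBracket I X (fun y ↦ phi y (Y y)) x)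

variable [IsManifold I ∞ M]

/-- Normality: `N + 2 dη ⊗ ξ = 0`. -/
def AlmostContactStructure.IsNormal (S : AlmostContactStructure I M) : Prop :=
  ∀ (x : M) (X Y : Π x : M, TangentSpace I x), CMDiffAt ∞ (T% X) x → CMDiffAt ∞ (T% Y) x →
    nijenhuis S.phi X Y x + (2 * extDerivOneForm S.eta X Y x) • S.xi x = 0

variable [RiemannianBundle (fun x : M ↦ TangentSpace I x)]

/-- The Riemannian metric of `M` is compatible with the almost contact structure:
`g(φ X, φ Y) = g(X, Y) - η(X) η(Y)` and `η(X) = g(X, ξ)`. -/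
structure AlmostContactStructure.IsMetric (S : AlmostContactStructure I M) : Prop where
  inner_phi_phi : ∀ (x : M) (v w : TangentSpace I x),
    inner ℝ (S.phi x v) (S.phi x w) = inner ℝ v w - S.eta x v * S.eta x w
  eta_eq : ∀ (x : M) (v : TangentSpace I x), S.eta x v = inner ℝ v (S.xi x)

/-- The contact condition: `dη` is the fundamental 2-form `(X, Y) ↦ g(X, φ Y)`. -/
def AlmostContactStructure.IsContact (S : AlmostContactStructure I M) : Prop :=
  ∀ (x : M) (X Y : Π x : M, TangentSpace I x), CMDiffAt ∞ (T% X) x → CMDiffAt ∞ (T% Y) x →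
    extDerivOneForm S.eta X Y x = inner ℝ (X x) (S.phi x (Y x))

/-- `M(φ, ξ, η, g)` is a Sasakian manifold: a normal contact metric structure. -/
structure AlmostContactStructure.IsSasakian (S : AlmostContactStructure I M) : Prop where
  isMetric : S.IsMetric
  isContact : S.IsContact
  isNormal : S.IsNormal

end AlmostContact

section Submersion

variable {E : Type*} [NormedAddCommGroup E] [NormedSpace ℝ E]
  {H : Type*} [TopologicalSpace H] (I : ModelWithCorners ℝ E H)
  {M : Type*} [TopologicalSpace M] [ChartedSpace H M]
  {E' : Type*} [NormedAddCommGroup E'] [NormedSpace ℝ E']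
  {H' : Type*} [TopologicalSpace H'] (I' : ModelWithCorners ℝ E' H')
  {N : Type*} [TopologicalSpace N] [ChartedSpace H' N]

/-- The vertical space `ker F_*` at `x`. -/
def verticalSpace (F : M → N) (x : M) : Submodule ℝ (TangentSpace I x) :=
  LinearMap.ker (mfderiv I I' F x).toLinearMap

variable [IsManifold I ∞ M] [RiemannianBundle (fun x : M ↦ TangentSpace I x)]

/-- The horizontal space `(ker F_*)^⊥` at `x`. -/
def horizontalSpace (F : M → N) (x : M) : Submodule ℝ (TangentSpace I x) :=
  (verticalSpace I I' F x)ᗮ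

variable [IsManifold I' ∞ N] [RiemannianBundle (fun y : N ↦ TangentSpace I' y)]

/-- A Riemannian submersion: a smooth map onto `N` whose differential has maximal rank and preserves
the lengths of horizontal vectors. -/
structure IsRiemannianSubmersion (F : M → N) : Prop where
  contMDiff : ContMDiff I I' ∞ F
  surjective : Function.Surjective F
  surjective_mfderiv : ∀ x, Function.Surjective (mfderiv I I' F x)
  norm_mfderiv : ∀ x, ∀ v ∈ horizontalSpace I I' F x, ‖mfderiv I I' F x v‖ = ‖v‖

variable {I}

/-- An anti-invariant Riemannian submersion: a Riemannian submersion with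
`φ(ker F_*) ⊆ (ker F_*)^⊥`. -/
structure IsAntiInvariantRiemannianSubmersion (S : AlmostContactStructure I M) (F : M → N) :
    Prop where
  isRiemannianSubmersion : IsRiemannianSubmersion I I' F
  phi_mem : ∀ x, ∀ v ∈ verticalSpace I I' F x, S.phi x v ∈ horizontalSpace I I' F x

end Submersion

end

end SasakianGeometry

namespace SasakianGeometry

section

variable {E : Type*} [NormedAddCommGroup E] [NormedSpace ℝ E]
  {H : Type*} [TopologicalSpace H] {I : ModelWithCorners ℝ E H}
  {M : Type*} [TopologicalSpace M] [ChartedSpace H M] [IsManifold I ∞ M]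

/-! The obstruction is that `∇ξ` pairs a vertical vector `v` nontrivially with the horizontal vector
`φ v`: `⟨∇_{φ v} ξ, v⟩ = ‖φ v‖²` (`inner_leviCivita_xi`). If the horizontal distribution were
totally geodesic, then `∇_{φ v} ξ` would be horizontal, since `ξ` and `φ v` are. The pairing would
vanish, so `φ v = 0`. But `η(v) = ⟨v, ξ⟩ = 0`, so `φ² v = -v` and `v = 0`. Since `n < 2m + 1`, some
vertical `v` is nonzero.

The pairing comes from the Koszul formula: the contact condition evaluates the `dη` part, and the
remaining bracket terms cancel because the flow of `ξ` preserves `φ` (`mlieBracket_xi_phi`) and `φ`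
is skew. -/

theorem AlmostContactStructure.contMDiffAt_phi_apply (S : AlmostContactStructure I M)
    {X : Π x : M, TangentSpace I x} {x : M} (hX : CMDiffAt ∞ (T% X) x) :
    CMDiffAt ∞ (T% (fun y ↦ S.phi y (X y))) x :=
  ContMDiffAt.clm_bundle_apply (S.contMDiff_phi x) hX

variable [RiemannianBundle (fun x : M ↦ TangentSpace I x)]

/-- Compatibility is applied to `v` and `φ w`: the correction term has the factor `η(φ w) = 0`, and
in `φ² w = -w + η(w) ξ` the `ξ` part is orthogonal to `φ v`. -/
theorem AlmostContactStructure.IsMetric.inner_phi_right {S : AlmostContactStructure I M}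
    (hS : S.IsMetric) (x : M) (v w : TangentSpace I x) :
    inner ℝ v (S.phi x w) = -inner ℝ (S.phi x v) w := by
  have h := hS.inner_phi_phi x v (S.phi x w)
  rw [S.eta_phi, mul_zero, sub_zero, S.phi_phi, inner_add_right, inner_neg_right,
    inner_smul_right, ← hS.eta_eq, S.eta_phi, mul_zero, add_zero] at h
  exact h.symm

theorem AlmostContactStructure.IsMetric.inner_phi_self {S : AlmostContactStructure I M}
    (hS : S.IsMetric) (x : M) (v : TangentSpace I x) : inner ℝ (S.phi x v) v = 0 := by
  have h := hS.inner_phi_right x v v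
  rw [real_inner_comm] at h
  linarith

/-- On a contact metric manifold `ξ` lies in the kernel of `dη`. -/
theorem AlmostContactStructure.IsContact.extDerivOneForm_xi_left {S : AlmostContactStructure I M}
    (hS : S.IsContact) (hm : S.IsMetric) {X : Π x : M, TangentSpace I x} {x : M}
    (hX : CMDiffAt ∞ (T% X) x) : extDerivOneForm S.eta S.xi X x = 0 := by
  rw [hS x S.xi X (S.contMDiff_xi x) hX, real_inner_comm, ← hm.eta_eq, S.eta_phi]

/-- On a Sasakian manifold the Lie derivative of `φ` along `ξ` vanishes. -/
theorem AlmostContactStructure.IsSasakian.mlieBracket_xi_phi {S : AlmostContactStructure I M}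
    (hS : S.IsSasakian) {X : Π x : M, TangentSpace I x} {x : M} (hX : CMDiffAt ∞ (T% X) x) :
    mlieBracket I S.xi (fun y ↦ S.phi y (X y)) x = S.phi x (mlieBracket I S.xi X x) := by
  have hφX := S.contMDiffAt_phi_apply hX
  have hφξ : (fun y ↦ S.phi y (S.xi y)) = (0 : Π x : M, TangentSpace I x) :=
    funext S.phi_xi
  have hN := hS.isNormal x S.xi X (S.contMDiff_xi x) hX
  rw [hS.isContact.extDerivOneForm_xi_left hS.isMetric hX] at hN
  simp only [nijenhuis, hφξ, mlieBracket_zero_left, Pi.zero_apply, map_zero, add_zero, mul_zero,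
    zero_smul, sub_zero] at hN
  -- In `2 dη(ξ, φ X) = 0` both derivative terms vanish, as `η(φ X) = 0` and `η(ξ) = 1` are
  -- constant; only the bracket term is left.
  have hη : S.eta x (mlieBracket I S.xi (fun y ↦ S.phi y (X y)) x) = 0 := by
    have h := hS.isContact.extDerivOneForm_xi_left hS.isMetric hφX
    simp only [extDerivOneForm, S.eta_phi, S.eta_xi, mvfderiv_const] at h
    simpa using h
  -- Normality has become `φ²[ξ, X] = φ[ξ, φ X]`. Applying `φ` once more turns the left side into
  -- `-φ[ξ, X]` and, by `hη`, the right side into `-[ξ, φ X]`.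
  have h := congrArg (S.phi x) hN
  rw [map_sub, S.phi_phi x (S.phi x _), S.eta_phi, S.phi_phi x (mlieBracket _ _ _ x), hη,
    map_zero] at h
  simp only [zero_smul, add_zero] at h
  rwa [sub_neg_eq_add, neg_add_eq_zero, eq_comm] at h

variable [FiniteDimensional ℝ E]
  [IsContMDiffRiemannianBundle I ∞ E (fun x : M ↦ TangentSpace I x)]

/-- The part `⟨∇_{φ v} ξ, v⟩ = ‖φ v‖²` of the identity `∇_X ξ = -φ X` on a Sasakian manifold. -/
theorem AlmostContactStructure.IsSasakian.inner_leviCivita_xi {S : AlmostContactStructure I M}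
    (hS : S.IsSasakian) (x : M) (v : TangentSpace I x) :
    inner ℝ (leviCivita I M S.xi x (S.phi x v)) v = inner ℝ (S.phi x v) (S.phi x v) := by
  -- The Koszul formula needs fields, so `v` is extended to a field smooth at `x`, and `φ v` by its
  -- image under `φ`.
  let Z : Π x : M, TangentSpace I x := FiberBundle.extend E v
  have hZ : CMDiffAt ∞ (T% Z) x := FiberBundle.contMDiffAt_extend ..
  have hZv : Z x = v := FiberBundle.extend_apply_self ..
  let W : Π x : M, TangentSpace I x := fun y ↦ S.phi y (Z y)
  have hW : CMDiffAt ∞ (T% W) x := S.contMDiffAt_phi_apply hZ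
  have hd : (∞ : WithTop ℕ∞) ≠ 0 := by simp
  have hK := inner_leviCivitaFun W S.xi Z x (hW.mdifferentiableAt hd)
    ((S.contMDiff_xi x).mdifferentiableAt hd) (hZ.mdifferentiableAt hd)
  have hC := hS.isContact x W Z hW hZ
  have hL := hS.mlieBracket_xi_phi hZ
  have hξZ : (fun y ↦ inner ℝ (S.xi y) (Z y)) = fun y ↦ S.eta y (Z y) :=
    funext fun y ↦ by rw [hS.isMetric.eta_eq, real_inner_comm]
  have hWξ : (fun y ↦ inner ℝ (W y) (S.xi y)) = fun y ↦ S.eta y (W y) :=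
    funext fun y ↦ by rw [hS.isMetric.eta_eq]
  have hZW : (fun y ↦ inner ℝ (Z y) (W y)) = fun _ ↦ (0 : ℝ) :=
    funext fun y ↦ by rw [real_inner_comm]; exact hS.isMetric.inner_phi_self y (Z y)
  have hskew := hS.isMetric.inner_phi_right x (mlieBracket I S.xi Z x) (Z x)
  change inner ℝ (leviCivita I M S.xi x (S.phi x (Z x))) (Z x) = _ at hK
  -- With `W = φ Z`, the formula becomes `2⟨∇_W ξ, Z⟩ = 2 dη(W, Z) - ⟨φ[ξ, Z], Z⟩ - ⟨[ξ, Z], φ Z⟩`.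
  -- The last two terms cancel by `hskew`, and `hC` gives `dη(W, Z) = ⟨W, φ Z⟩`.
  rw [koszul, hξZ, hWξ, hZW, mlieBracket_swap (V := W) (W := S.xi), Pi.neg_apply, inner_neg_left,
    hL, ← hS.isMetric.eta_eq] at hK
  rw [extDerivOneForm] at hC
  have h0 : mvfderiv I (fun _ : M ↦ (0 : ℝ)) x (S.xi x) = 0 := by
    rw [mvfderiv_const, zero_apply]
  rw [h0] at hK
  simp only [W, hZv] at hK hC hskew
  linarith

end

end SasakianGeometry

theorem theorem10 (m n : ℕ)
    {E : Type*} [NormedAddCommGroup E] [NormedSpace ℝ E] [FiniteDimensional ℝ E]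
    (hE : Module.finrank ℝ E = 2 * m + 1)
    {M : Type*} [TopologicalSpace M] [T2Space M] [SecondCountableTopology M] [Nonempty M]
    [ChartedSpace E M] [IsManifold 𝓘(ℝ, E) ∞ M]
    [RiemannianBundle (fun x : M ↦ TangentSpace 𝓘(ℝ, E) x)]
    [IsContMDiffRiemannianBundle 𝓘(ℝ, E) ∞ E (fun x : M ↦ TangentSpace 𝓘(ℝ, E) x)]
    {E' : Type*} [NormedAddCommGroup E'] [NormedSpace ℝ E'] [FiniteDimensional ℝ E']
    (hE' : Module.finrank ℝ E' = n)
    {N : Type*} [TopologicalSpace N] [T2Space N] [SecondCountableTopology N]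
    [ChartedSpace E' N] [IsManifold 𝓘(ℝ, E') ∞ N]
    [RiemannianBundle (fun y : N ↦ TangentSpace 𝓘(ℝ, E') y)]
    [IsContMDiffRiemannianBundle 𝓘(ℝ, E') ∞ E' (fun y : N ↦ TangentSpace 𝓘(ℝ, E') y)]
    -- the fibres, of dimension `2m + 1 - n`, are not discrete
    (hn : n < 2 * m + 1)
    (S : SasakianGeometry.AlmostContactStructure 𝓘(ℝ, E) M) (hS : S.IsSasakian)
    (F : M → N)
    (hF : SasakianGeometry.IsAntiInvariantRiemannianSubmersion 𝓘(ℝ, E') S F)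
    (hxi : ∀ x, S.xi x ∈ SasakianGeometry.horizontalSpace 𝓘(ℝ, E) 𝓘(ℝ, E') F x) :
    ¬ SasakianGeometry.DefinesTotallyGeodesicFoliation
      (SasakianGeometry.horizontalSpace 𝓘(ℝ, E) 𝓘(ℝ, E') F) := by
  intro hG
  obtain ⟨x⟩ := ‹Nonempty M›
  obtain ⟨v, hv, hv0⟩ : ∃ v ∈ SasakianGeometry.verticalSpace 𝓘(ℝ, E) 𝓘(ℝ, E') F x, v ≠ 0 := by
    refine (Submodule.ne_bot_iff _).1 ?_
    have : FiniteDimensional ℝ (TangentSpace 𝓘(ℝ, E) x) :=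
      SasakianGeometry.finiteDimensional_tangentSpace x
    have : FiniteDimensional ℝ (TangentSpace 𝓘(ℝ, E') (F x)) :=
      SasakianGeometry.finiteDimensional_tangentSpace (F x)
    refine LinearMap.ker_ne_bot_of_finrank_lt ?_
    change Module.finrank ℝ E' < Module.finrank ℝ E
    rwa [hE, hE']
  -- Anti-invariance makes `φ v` an admissible direction for differentiating the horizontal field
  -- `ξ`.
  have hh := hG S.xi S.contMDiff_xi hxi x (S.phi x v) (hF.phi_mem x v hv)
  have h0 : inner ℝ (SasakianGeometry.leviCivita 𝓘(ℝ, E) M S.xi x (S.phi x v)) v = 0 :=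
    Submodule.inner_left_of_mem_orthogonal hv hh
  rw [hS.inner_leviCivita_xi, inner_self_eq_zero] at h0
  have hη : S.eta x v = 0 := by
    rw [hS.isMetric.eta_eq]
    exact Submodule.inner_right_of_mem_orthogonal hv (hxi x)
  have h := S.phi_phi x v
  rw [h0, map_zero, hη, zero_smul, add_zero] at h
  exact hv0 (neg_eq_zero.1 h.symm)
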